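/- **Conventions.** An *edge-ordered graph* is a finite simple graph with a linear order on its edge set. It *contains* an edge-ordered graph $H$ if $H$ is isomorphic, as an edge-ordered graph, to one of its (not necessarily induced) subgraphs with the inherited edge-order; otherwise it *avoids* $H$. It avoids a family $\mathcal H$ if it avoids every member of $\mathcal H$. A simple graph *can avoid* $\mathcal H$ if it has an edge-order with which it avoids $\mathcal H$. The *order chromatic number* $\chi'_<(\mathcal H)$ is the smallest chromatic number of a finite simple graph that cannot avoid $\mathcal H$, and $\infty$ if every finite simple graph can avoid $\mathcal H$. The four *canonical labelings* of $K_n$ (vertices $v_1,\dots,v_n$) give the edge $v_iv_j$ with $i<j$ the label $ni+j$ (min), $nj+i$ (max), $ni-j$ (inverse min), $nj-i$ (inverse max), respectively; the edges are ordered by their labels. Let $K_{k\times n}$ be the complete $k$-partite graph with classes $V_i=\{v_{i,1},\dots,v_{i,n}\}$, $1\le i\le k$. For $a\ne b$, the complete bipartite graph between $V_a$ and $V_b$ is called a *part*. An edge-order of $K_{k\times n}$ is *canonical* if 1. on each part, between $V_a$ and $V_b$ say, it is the order given by one of the eight labelings $v_{a,j}v_{b,j'}\mapsto \pm nj\pm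 j'$, $v_{a,j}v_{b,j'}\mapsto \pm nj'\pm j$; and 2. for any two distinct parts, either all edges of one come before all edges of the other, or the two parts are *interleaved*: they share a class $V_a$, say they are the parts between $V_a,V_b$ and between $V_a,V_c$ with $b\neq c$, and one of the relations $\prec$ among $<,\le,>,\ge$ is such that for all $j_1,j_2,j_3,j_4\in\{1,\dots,n\}$ the edge $v_{a,j_1}v_{b,j_2}$ precedes the edge $v_{a,j_3}v_{c,j_4}$ if and only if $j_1\prec j_3$. **Theorem.** Let $\mathcal H$ be a (finite or infinite) family of edge-ordered graphs, each with at least one edge. - The following are equivalent: $\chi'_<(\mathcal H)=\infty$; there is one of the four types of canonical labeling such that, for all $n$, the graph $K_n$ with the canonical labeling of that type avoids $\mathcal H$; for all $n$ there is one of the four canonical labelings with which $K_n$ avoids $\mathcal H$. - For every $k\ge 2$, $\chi'_<(\mathcal H)>k$ if and only if for all $n$ there is a canonical edge-order with which $K_{k\times n}$ avoids $\mathcal H$. -/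

import Mathlib

universe u v

/-- An edge-ordered graph: a finite simple graph with a linear order on its edge set. -/
structure EdgeOrderedGraph where
  V : Type u
  [finite : Finite V]
  graph : SimpleGraph V
  order : LinearOrder graph.edgeSet

namespace EdgeOrderedGraph

/-- `G` contains `H`: there is an injective graph homomorphism from `H` to `G` (equivalently, an
isomorphism of `H` with a not necessarily induced subgraph of `G`) under which the order of the
edges of `H` is the order inherited from `G`. -/
def Contains (G : EdgeOrderedGraph.{u}) (H : EdgeOrderedGraph.{v}) : Prop :=
  ∃ f : SimpleGraph.Copy H.graph G.graph, ∀ e e' : H.graph.edgeSet,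
    H.order.lt e e' ↔ G.order.lt (f.mapEdgeSet e) (f.mapEdgeSet e')

/-- `G` avoids the family `𝓗`: it contains no member of the family. -/
def Avoids (G : EdgeOrderedGraph.{u}) (𝓗 : Set EdgeOrderedGraph.{v}) : Prop :=
  ∀ H ∈ 𝓗, ¬ G.Contains H

/-- A simple graph can avoid `𝓗` if some edge-ordering of it avoids `𝓗`. -/
def CanAvoid {V : Type u} [Finite V] (G : SimpleGraph V)
    (𝓗 : Set EdgeOrderedGraph.{v}) : Prop :=
  ∃ o : LinearOrder G.edgeSet, Avoids ⟨V, G, o⟩ 𝓗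

/-- The order chromatic number of `𝓗`: the least chromatic number of a finite simple graph that
cannot avoid `𝓗`. It is `⊤`, the infimum of the empty set, if all finite simple graphs can
avoid `𝓗`. -/
noncomputable def orderChromaticNumber (𝓗 : Set EdgeOrderedGraph.{v}) : ℕ∞ :=
  sInf {c | ∃ (V : Type) (_ : Finite V) (G : SimpleGraph V),
    ¬ CanAvoid G 𝓗 ∧ G.chromaticNumber = c}

/-! ### Canonical labelings of the complete graph -/

/-- The names of the four canonical labelings of a complete graph. -/
inductive CanonicalType where
  | min
  | max
  | invMin
  | invMax

/-- The label of the edge `v_i v_j` of `K_n`, where `1 ≤ i < j ≤ n`. -/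
def CanonicalType.label (n : ℕ) : CanonicalType → ℤ → ℤ → ℤ
  | .min, i, j => n * i + j
  | .max, i, j => n * j + i
  | .invMin, i, j => n * i - j
  | .invMax, i, j => n * j - i

/-- The index `1, …, n` of an element of `Fin n`. -/
def idx {n : ℕ} (j : Fin n) : ℤ := (j : ℤ) + 1

/-- The canonical labeling of type `c` on the edges of `K_n`, the vertex `v_i` being
the element `i - 1` of `Fin n`. -/
def completeLabel (c : CanonicalType) (n : ℕ) (e : (⊤ : SimpleGraph (Fin n)).edgeSet) : ℤ :=
  c.label n (idx e.1.inf) (idx e.1.sup)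

theorem eq_of_mul_add_eq {n a a' b b' : ℤ} (h : n * a + b = n * a' + b')
    (h1 : b - b' < n) (h2 : b' - b < n) : a = a' ∧ b = b' := by
  have hn : 0 < n := by omega
  have ha : a = a' := by
    rcases lt_trichotomy a a' with hlt | heq | hgt
    · nlinarith [mul_le_mul_of_nonneg_left (Int.add_one_le_iff.mpr hlt) hn.le]
    · exact heq
    · nlinarith [mul_le_mul_of_nonneg_left (Int.add_one_le_iff.mpr hgt) hn.le]
  subst ha
  exact ⟨rfl, by linarith⟩

theorem completeLabel_injective (c : CanonicalType) (n : ℕ) :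
    Function.Injective (completeLabel c n) := by
  intro e e' h
  have key : e.1.inf = e'.1.inf ∧ e.1.sup = e'.1.sup := by
    have b1 := e.1.inf.isLt
    have b2 := e.1.sup.isLt
    have b3 := e'.1.inf.isLt
    have b4 := e'.1.sup.isLt
    simp only [Fin.ext_iff]
    cases c <;> simp only [completeLabel, CanonicalType.label, idx, sub_eq_add_neg] at h <;>
      obtain ⟨h1, h2⟩ := eq_of_mul_add_eq h (by omega) (by omega) <;> omega
  exact Subtype.ext (Sym2.inf_eq_inf_and_sup_eq_sup.mp key)

/-- The complete graph `K_n` with its canonical labeling of type `c`. -/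
noncomputable def canonicalComplete (c : CanonicalType) (n : ℕ) : EdgeOrderedGraph.{0} where
  V := Fin n
  graph := ⊤
  order := LinearOrder.lift' (completeLabel c n) (completeLabel_injective c n)

/-! ### Canonical edge-orders of the complete multipartite graph

The graph `K_{k×n}` is `SimpleGraph.completeEquipartiteGraph k n`, on the vertex set
`Fin k × Fin n`, where `(i, j)` is the `j`-th vertex of the `i`-th class. -/

/-- The edge of `K_{k×n}` between the vertices `(a, j)` and `(b, j')`, where `a ≠ b`. -/
def multiEdge {k n : ℕ} {a b : Fin k} (h : a ≠ b) (j j' : Fin n) :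
    (SimpleGraph.completeEquipartiteGraph k n).edgeSet :=
  ⟨s((a, j), (b, j')), h⟩

/-- The eight labelings, as functions of the indices in `1, …, n` of the two endpoints. -/
def partLabels (n : ℕ) : List (ℤ → ℤ → ℤ) :=
  [fun x y => n * x + y, fun x y => n * x - y, fun x y => -(n * x) + y, fun x y => -(n * x) - y,
   fun x y => n * y + x, fun x y => n * y - x, fun x y => -(n * y) + x, fun x y => -(n * y) - x]

section Multipartite

variable {k n : ℕ} (o : LinearOrder (SimpleGraph.completeEquipartiteGraph k n).edgeSet)

/-- The order induced on the complete bipartite graph between classes `a` and `b` is the one given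
by one of the eight labelings. -/
def PartCanonical {a b : Fin k} (h : a ≠ b) : Prop :=
  ∃ L ∈ partLabels n, ∀ i j i' j' : Fin n,
    o.lt (multiEdge h i j) (multiEdge h i' j') ↔ L (idx i) (idx j) < L (idx i') (idx j')

/-- All edges between classes `a`, `b` come before all edges between classes `c`, `d`. -/
def PartPrecedes {a b c d : Fin k} (h : a ≠ b) (h' : c ≠ d) : Prop :=
  ∀ i j i' j' : Fin n, o.lt (multiEdge h i j) (multiEdge h' i' j')

/-- The edges between classes `a`, `b` and those between classes `a`, `c` are interleaved: their
relative order is determined, in one of four ways, by their endpoints in class `a`. -/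
def PartsInterleaved {a b c : Fin k} (h : a ≠ b) (h' : a ≠ c) : Prop :=
  (∀ i j i' j' : Fin n, o.lt (multiEdge h i j) (multiEdge h' i' j') ↔ i < i') ∨
  (∀ i j i' j' : Fin n, o.lt (multiEdge h i j) (multiEdge h' i' j') ↔ i ≤ i') ∨
  (∀ i j i' j' : Fin n, o.lt (multiEdge h i j) (multiEdge h' i' j') ↔ i > i') ∨
  (∀ i j i' j' : Fin n, o.lt (multiEdge h i j) (multiEdge h' i' j') ↔ i ≥ i')

/-- An edge-order of `K_{k×n}` is canonical: it is canonical on every part (a part being the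
complete bipartite graph between two classes), and of any two distinct parts one precedes the
other or they are interleaved. Two distinct parts share at most one class, and they can be
interleaved only if they share one; the two last fields treat the parts that share a class and
those that do not. -/
structure IsCanonical : Prop where
  part : ∀ {a b : Fin k} (h : a ≠ b), PartCanonical o h
  share : ∀ {a b c : Fin k} (h : a ≠ b) (h' : a ≠ c), b ≠ c →
    PartPrecedes o h h' ∨ PartPrecedes o h' h ∨ PartsInterleaved o h h'
  disjoint : ∀ {a b c d : Fin k} (h : a ≠ b) (h' : c ≠ d),
    a ≠ c → a ≠ d → b ≠ c → b ≠ d → PartPrecedes o h h' ∨ PartPrecedes o h' h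

end Multipartite

/-- The complete `k`-partite graph `K_{k×n}` with the edge-order `o`. -/
def multipartite {k n : ℕ} (o : LinearOrder (SimpleGraph.completeEquipartiteGraph k n).edgeSet) :
    EdgeOrderedGraph.{0} where
  V := Fin k × Fin n
  graph := SimpleGraph.completeEquipartiteGraph k n
  order := o

end EdgeOrderedGraph

/-!
Everything rests on Ramsey's theorem. In the form `exists_orderEmbedding_homogeneous` it says
that any edge-order of a large graph can be restricted so that the comparison of two edges
depends only on the order type of their four endpoints; it is proved by taking iterated limits
of the coloring along a nonprincipal ultrafilter on `ℕ`, which also replaces the compactness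
argument that leads from `ℕ` to a finite bound.

*Complete graphs.* If comparisons depend only on order types, then, after reversing the order of
the vertices if necessary, an edge precedes the edges that lie entirely to its right.
Transitivity then forces `v_i v_j < v_i' v_j'` whenever `i < i'` and `j < j'`, and leaves
exactly the four canonical labelings (`Homogeneous.exists_lex`). So every edge-order of a large
complete graph contains a canonical one (`exists_contains_canonicalComplete`). One of the four
types serves all `n`, because a canonical `K_n` contains the smaller ones of its type.

*Multipartite graphs.* The vertices of the `k` classes are placed in disjoint intervals of a
homogeneous set. The order on a part then depends on the two signs of monotonicity in the
endpoints and on which endpoint dominates (`exists_partLabel`). The comparison between two parts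
that share a class depends only on whether `i < i'`, `i = i'` or `i > i'` for the endpoints in
that class; the two of the eight resulting patterns that are not monotone would give a cycle of
edges. The comparison between two parts without a common class is constant. Hence
`exists_isCanonical`.

*Chromatic numbers.* A finite graph is a subgraph of some `K_n`, and it is `k`-colorable if and
only if it is a subgraph of some `K_{k×n}`, and edge-orders that avoid a family restrict to
subgraphs. So the order chromatic number is infinite, or greater than `k`, if and only if all
the graphs `K_n`, or all the graphs `K_{k×n}`, can avoid the family.
-/

universe w

/-! ### Ramsey's theorem for order types -/

open Filter in
theorem Ultrafilter.exists_eventually_eq {α X : Type*} [Finite α] (U : Ultrafilter X) (f : X → α) :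
    ∃ a, ∀ᶠ x in (U : Filter X), f x = a := by
  obtain ⟨a, ha⟩ := (U.map f).eq_pure_of_finite
  refine ⟨a, ?_⟩
  have h : ({a} : Set α) ∈ U.map f := by rw [ha]; exact Set.mem_singleton a
  exact h

open Filter in
/-- Ramsey's theorem, for all sizes of subsets at once: if the finite subsets of `ℕ` are colored
with finitely many colors, then there are arbitrarily large finite sets in which the color of
a subset depends only on its size. -/
theorem exists_homogeneous_finset {α : Type*} [Finite α] (c : Finset ℕ → α) (m : ℕ) :
    ∃ H : Finset ℕ, H.card = m ∧
      ∀ t ⊆ H, ∀ t' ⊆ H, t.card = t'.card → c t = c t' := by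
  choose lim hlim using (hyperfilter ℕ).exists_eventually_eq (α := α)
  -- `L d t` is the iterated limit of the color of `t` with `d` further elements added.
  let L : ℕ → Finset ℕ → α := fun d => Nat.rec c (fun _ ih t => lim fun x => ih (insert x t)) d
  have hL (d : ℕ) (t : Finset ℕ) :
      ∀ᶠ x in (hyperfilter ℕ : Filter ℕ), L d (insert x t) = L (d + 1) t :=
    hlim fun x => L d (insert x t)
  have key (r n : ℕ) : ∃ H : Finset ℕ, H.card = n ∧
      ∀ t ⊆ H, ∀ d, t.card + d ≤ r → L d t = L (t.card + d) ∅ := by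
    induction n with
    | zero =>
      refine ⟨∅, rfl, fun t ht d _ => ?_⟩
      rw [Finset.subset_empty.mp ht, Finset.card_empty, zero_add]
    | succ n ih =>
      obtain ⟨H, hH, hc⟩ := ih
      have h1 : ∀ᶠ x in (hyperfilter ℕ : Filter ℕ), x ∉ H :=
        compl_mem_hyperfilter_of_finite H.finite_toSet
      have h2 : ∀ᶠ x in (hyperfilter ℕ : Filter ℕ), ∀ t ∈ H.powerset, ∀ d ∈ Finset.range r,
          L d (insert x t) = L (d + 1) t := by
        rw [eventually_all_finset]
        intro t _
        rw [eventually_all_finset]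
        exact fun d _ => hL d t
      obtain ⟨x, hx, hxL⟩ := (h1.and h2).exists
      refine ⟨insert x H, by rw [Finset.card_insert_of_notMem hx, hH], fun t ht d hd => ?_⟩
      by_cases hxt : x ∈ t
      · have hs : t.erase x ⊆ H := Finset.subset_insert_iff.mp ht
        have hcard := Finset.card_erase_add_one hxt
        have h3 := hxL _ (Finset.mem_powerset.mpr hs) d (Finset.mem_range.mpr (by omega))
        rw [Finset.insert_erase hxt, hc _ hs (d + 1) (by omega)] at h3
        rw [h3, ← hcard, add_assoc, add_comm 1 d]
      · exact hc t ((Finset.subset_insert_iff_of_notMem hxt).mp ht) d hd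
  obtain ⟨H, hH, hc⟩ := key m m
  refine ⟨H, hH, fun t ht t' ht' htt => ?_⟩
  have h1 := hc t ht 0 (by simpa [hH] using Finset.card_le_card ht)
  have h2 := hc t' ht' 0 (by simpa [hH] using Finset.card_le_card ht')
  rw [htt] at h1
  exact h1.trans h2.symm

theorem Finset.card_image_le_card_image {α β γ : Type*} [DecidableEq β] [DecidableEq γ]
    {s : Finset α} {u : α → β} {v : α → γ} (h : ∀ p q, v p = v q → u p = u q) :
    (s.image u).card ≤ (s.image v).card := by
  obtain rfl | ⟨a, -⟩ := s.eq_empty_or_nonempty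
  · simp
  have hf : u.FactorsThrough v := fun p q => h p q
  have hu : s.image u = (s.image v).image (Function.extend v u fun _ => u a) := by
    rw [Finset.image_image]
    exact Finset.image_congr fun p _ => (hf.extend_apply _ p).symm
  rw [hu]
  exact Finset.card_image_le

/-- Ramsey's theorem for order types: every finite coloring of the `r`-tuples in a large finite
linear order is, on a copy of the given linear order `ι`, determined by the order type
of the tuple. -/
theorem exists_orderEmbedding_homogeneous (ι : Type*) [Finite ι] [LinearOrder ι] (α : Type*)
    [Finite α] [Nonempty α] (r : ℕ) :
    ∃ N : ℕ, ∀ R : (Fin r → Fin N) → α, ∃ φ : ι ↪o Fin N, ∀ u v : Fin r → ι,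
      (∀ p q, u p < u q ↔ v p < v q) → R (φ ∘ u) = R (φ ∘ v) := by
  classical
  have := Fintype.ofFinite ι
  -- Given a bad coloring `R N` for every `N`, pass to the limit coloring of the subsets of `ℕ`;
  -- on a given finite homogeneous set it agrees with the colorings for many large `N`.
  by_contra! hbad
  choose R hR using hbad
  choose lim hlim using (Filter.hyperfilter ℕ).exists_eventually_eq (α := (Fin r → Fin r) → α)
  -- The color of `t` records the colors of all tuples with entries among its first `r` elements.
  let c (N : ℕ) (t : Finset ℕ) (p : Fin r → Fin r) : α :=
    if h : ∀ i, Nat.nth (· ∈ t) (p i) < N then R N fun i => ⟨_, h i⟩ else Classical.arbitrary α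
  obtain ⟨H, hH, hc⟩ := exists_homogeneous_finset (fun t => lim fun N => c N t) (Fintype.card ι)
  have h1 : ∀ᶠ N in (Filter.hyperfilter ℕ : Filter ℕ), H.sup id < N :=
    Nat.hyperfilter_le_atTop (Filter.eventually_gt_atTop _)
  have h2 : ∀ᶠ N in (Filter.hyperfilter ℕ : Filter ℕ), ∀ t ∈ H.powerset,
      c N t = lim fun N => c N t := by
    rw [Filter.eventually_all_finset]
    exact fun t _ => hlim fun N => c N t
  obtain ⟨N, hN, hcN⟩ := (h1.and h2).exists
  have hlt (x : ℕ) (hx : x ∈ H) : x < N := (Finset.le_sup (f := id) hx).trans_lt hN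
  let e : ι ↪o ℕ := (Fintype.orderIsoFinOfCardEq ι rfl).symm.toOrderEmbedding.trans
    (H.orderEmbOfFin hH)
  have heH (i : ι) : e i ∈ H := H.orderEmbOfFin_mem hH _
  let φ : ι ↪o Fin N := OrderEmbedding.ofStrictMono (fun i => ⟨e i, hlt _ (heH i)⟩)
    fun i j hij => e.strictMono hij
  obtain ⟨u, v, huv, hne⟩ := hR N φ
  -- The rank of an entry of a tuple among the entries.
  have hcount (w : Fin r → ι) (p : Fin r) :
      Nat.count (· ∈ Finset.univ.image (e ∘ w)) (e (w p)) =
        ((Finset.univ.filter fun q => w q < w p).image w).card := by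
    rw [Nat.count_eq_card_filter_range, ← Finset.card_image_of_injective _ e.injective]
    congr 1
    ext x
    simp only [Finset.mem_filter, Finset.mem_range, Finset.mem_image, Finset.mem_univ, true_and,
      Function.comp_apply]
    constructor
    · rintro ⟨hx, q, rfl⟩
      exact ⟨w q, ⟨q, e.lt_iff_lt.mp hx, rfl⟩, rfl⟩
    · rintro ⟨_, ⟨q, hq, rfl⟩, rfl⟩
      exact ⟨e.lt_iff_lt.mpr hq, q, rfl⟩
  have heq (p q : Fin r) : u p = u q ↔ v p = v q := by
    simp only [le_antisymm_iff, ← not_lt, huv]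
  have hcard (s : Finset (Fin r)) : (s.image u).card = (s.image v).card :=
    le_antisymm (Finset.card_image_le_card_image fun p q h => (heq p q).mpr h)
      (Finset.card_image_le_card_image fun p q h => (heq p q).mp h)
  have hsub (w : Fin r → ι) : Finset.univ.image (e ∘ w) ⊆ H := by
    simp [Finset.image_subset_iff, heH]
  have hcardt (w : Fin r → ι) :
      (Finset.univ.image (e ∘ w)).card = (Finset.univ.image w).card := by
    rw [← Finset.image_image, Finset.card_image_of_injective _ e.injective]
  have hrank (w : Fin r → ι) (p : Fin r) :
      ((Finset.univ.filter fun q => w q < w p).image w).card < r := by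
    refine Finset.card_image_le.trans_lt ?_
    exact (Finset.card_lt_card (Finset.filter_ssubset (p := fun q => w q < w p) |>.mpr
      ⟨p, Finset.mem_univ p, lt_irrefl _⟩)).trans_eq (Finset.card_fin r)
  have hranks (p : Fin r) : ((Finset.univ.filter fun q => u q < u p).image u).card =
      ((Finset.univ.filter fun q => v q < v p).image v).card := by
    simp only [hcard, huv]
  have hval (w : Fin r → ι) : c N (Finset.univ.image (e ∘ w)) (fun p => ⟨_, hrank w p⟩) =
      R N (φ ∘ w) := by
    have hnth (p : Fin r) : Nat.nth (· ∈ Finset.univ.image (e ∘ w))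
        ((Finset.univ.filter fun q => w q < w p).image w).card = e (w p) := by
      rw [← hcount]
      exact Nat.nth_count (p := (· ∈ Finset.univ.image (e ∘ w)))
        (Finset.mem_image_of_mem (e ∘ w) (Finset.mem_univ p))
    have hall (p : Fin r) : Nat.nth (· ∈ Finset.univ.image (e ∘ w))
        ((Finset.univ.filter fun q => w q < w p).image w).card < N :=
      (hnth p).trans_lt (hlt _ (heH _))
    exact (dif_pos hall).trans (congrArg (R N) (funext fun p => Fin.ext (hnth p)))
  have hcol := hc _ (hsub u) _ (hsub v) (by rw [hcardt, hcardt, hcard])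
  rw [← hcN _ (Finset.mem_powerset.mpr (hsub u)),
    ← hcN _ (Finset.mem_powerset.mpr (hsub v))] at hcol
  refine hne ?_
  rw [← hval u, ← hval v, hcol]
  simp only [hranks]

namespace EdgeOrderedGraph

/-! ### Containment and induced edge-orders -/

theorem Contains.trans {G : EdgeOrderedGraph.{u}} {H : EdgeOrderedGraph.{v}}
    {K : EdgeOrderedGraph.{w}} (hGH : G.Contains H) (hHK : H.Contains K) : G.Contains K := by
  obtain ⟨f, hf⟩ := hGH
  obtain ⟨g, hg⟩ := hHK
  refine ⟨f.comp g, fun e e' => ?_⟩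
  have hcomp (e : K.graph.edgeSet) :
      (f.comp g).mapEdgeSet e = f.mapEdgeSet (g.mapEdgeSet e) :=
    Subtype.ext (Sym2.map_map (f := g.toHom) (g := f.toHom) (e : Sym2 K.V)).symm
  rw [hcomp, hcomp, hg, hf]

theorem Avoids.mono {G : EdgeOrderedGraph.{u}} {H : EdgeOrderedGraph.{w}}
    {𝓗 : Set EdgeOrderedGraph.{v}} (hG : G.Avoids 𝓗) (hGH : G.Contains H) : H.Avoids 𝓗 :=
  fun K hK hHK => hG K hK (hGH.trans hHK)

/-- The edge-order that a copy of `G` in `G'` inherits from an edge-order of `G'`. -/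
abbrev inducedOrder {V : Type u} {V' : Type w} {G : SimpleGraph V} {G' : SimpleGraph V'}
    (f : SimpleGraph.Copy G G') (o : LinearOrder G'.edgeSet) : LinearOrder G.edgeSet :=
  @LinearOrder.lift' _ _ o f.mapEdgeSet f.mapEdgeSet.injective

theorem contains_inducedOrder {V : Type u} {V' : Type w} [Finite V] [Finite V']
    {G : SimpleGraph V} {G' : SimpleGraph V'} (f : SimpleGraph.Copy G G')
    (o : LinearOrder G'.edgeSet) : Contains ⟨V', G', o⟩ ⟨V, G, inducedOrder f o⟩ :=
  ⟨f, fun _ _ => Iff.rfl⟩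

theorem CanAvoid.of_copy {V : Type u} {V' : Type w} [Finite V] [Finite V']
    {G : SimpleGraph V} {G' : SimpleGraph V'} {𝓗 : Set EdgeOrderedGraph.{v}}
    (h : CanAvoid G' 𝓗) (f : SimpleGraph.Copy G G') : CanAvoid G 𝓗 := by
  obtain ⟨o, ho⟩ := h
  exact ⟨inducedOrder f o, ho.mono (contains_inducedOrder f o)⟩

theorem exists_strictMono_nat (E : Type*) [Finite E] [LinearOrder E] :
    ∃ f : E → ℕ, StrictMono f := by
  have := Fintype.ofFinite E
  exact ⟨fun e => (Fintype.orderIsoFinOfCardEq E rfl).symm e,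
    fun e e' h => (Fintype.orderIsoFinOfCardEq E rfl).symm.strictMono h⟩

/-- Every edge-order is given by a labeling with natural numbers. The labeling is written as
a function of two vertices; its values at nonadjacent vertices are irrelevant. -/
theorem exists_labeling {V : Type u} [Finite V] {G : SimpleGraph V} (o : LinearOrder G.edgeSet) :
    ∃ g : V → V → ℕ, (∀ x y, g x y = g y x) ∧
      ∀ x y x' y' (h : G.Adj x y) (h' : G.Adj x' y'),
        o.lt ⟨s(x, y), h⟩ ⟨s(x', y'), h'⟩ ↔ g x y < g x' y' := by
  classical
  obtain ⟨f, hf⟩ := @exists_strictMono_nat G.edgeSet _ o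
  refine ⟨fun x y => if h : s(x, y) ∈ G.edgeSet then f ⟨s(x, y), h⟩ else 0,
    fun x y => by simp only [Sym2.eq_swap (a := x)], fun x y x' y' h h' => ?_⟩
  have hdif {x y : V} (h : G.Adj x y) :
      (if h : s(x, y) ∈ G.edgeSet then f ⟨s(x, y), h⟩ else 0) = f ⟨s(x, y), h⟩ :=
    dif_pos (show s(x, y) ∈ G.edgeSet from h)
  simp only [hdif h, hdif h']
  exact (@StrictMono.lt_iff_lt _ _ o _ f hf ⟨s(x, y), h⟩ ⟨s(x', y'), h'⟩).symm

theorem labeling_inj {V : Type u} {G : SimpleGraph V} {o : LinearOrder G.edgeSet}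
    {g : V → V → ℕ}
    (hg : ∀ x y x' y' (h : G.Adj x y) (h' : G.Adj x' y'),
        o.lt ⟨s(x, y), h⟩ ⟨s(x', y'), h'⟩ ↔ g x y < g x' y')
    {x y x' y' : V} (h : G.Adj x y) (h' : G.Adj x' y') (heq : g x y = g x' y') :
    s(x, y) = s(x', y') := by
  have h1 : ¬ o.lt ⟨s(x, y), h⟩ ⟨s(x', y'), h'⟩ := by rw [hg]; omega
  have h2 : ¬ o.lt ⟨s(x', y'), h'⟩ ⟨s(x, y), h⟩ := by rw [hg]; omega
  have h3 := (@lt_trichotomy _ o ⟨s(x, y), h⟩ ⟨s(x', y'), h'⟩).resolve_left h1 |>.resolve_right h2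
  exact congrArg Subtype.val h3

theorem mul_add_lt_mul_add_iff {n a a' b b' : ℤ} (h1 : b - b' < n) (h2 : b' - b < n) :
    n * a + b < n * a' + b' ↔ a < a' ∨ a = a' ∧ b < b' := by
  rcases lt_trichotomy a a' with hlt | rfl | hgt
  · have : n * a + n ≤ n * a' := by nlinarith
    simp only [hlt, true_or, iff_true]; omega
  · simp
  · have : n * a' + n ≤ n * a := by nlinarith
    constructor <;> intro h <;> omega

/-! ### Canonical labelings of complete graphs -/

/-- The lexicographic conditions that describe the four canonical labelings. -/
def CanonicalType.Lex {ι : Type*} [LT ι] : CanonicalType → ι → ι → ι → ι → Prop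
  | .min, i, j, i', j' => i < i' ∨ i = i' ∧ j < j'
  | .max, i, j, i', j' => j < j' ∨ j = j' ∧ i < i'
  | .invMin, i, j, i', j' => i < i' ∨ i = i' ∧ j' < j
  | .invMax, i, j, i', j' => j < j' ∨ j = j' ∧ i' < i

theorem CanonicalType.label_lt_label_iff (c : CanonicalType) {n : ℕ} (i j i' j' : Fin n) :
    c.label n (idx i) (idx j) < c.label n (idx i') (idx j') ↔ c.Lex i j i' j' := by
  cases c <;> simp only [label, Lex, sub_eq_add_neg] <;>
    rw [mul_add_lt_mul_add_iff (by simp only [idx]; omega) (by simp only [idx]; omega)] <;>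
    simp only [idx, Fin.ext_iff, Fin.lt_def] <;> omega

section Homogeneous

variable {ι : Type*} [LinearOrder ι] {g : ι → ι → ℕ}

/-- A comparison of the labels of two edges only depends on the order type of the four
endpoints. -/
def Homogeneous (g : ι → ι → ℕ) : Prop :=
  ∀ u v : Fin 4 → ι, (∀ p q, u p < u q ↔ v p < v q) →
    (g (u 0) (u 1) < g (u 2) (u 3) ↔ g (v 0) (v 1) < g (v 2) (v 3))

theorem Homogeneous.lt_iff (hg : Homogeneous g) {s : ℕ} {x y : Fin s → ι} (hx : StrictMono x)
    (hy : StrictMono y) (p₀ p₁ p₂ p₃ : Fin s) :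
    g (x p₀) (x p₁) < g (x p₂) (x p₃) ↔ g (y p₀) (y p₁) < g (y p₂) (y p₃) := by
  refine hg ![x p₀, x p₁, x p₂, x p₃] ![y p₀, y p₁, y p₂, y p₃] ?_
  simp [Fin.forall_fin_succ, hx.lt_iff_lt, hy.lt_iff_lt]

theorem strictMono_three {i j k : ι} (hij : i < j) (hjk : j < k) : StrictMono ![i, j, k] := by
  simp [Fin.strictMono_iff_lt_succ, Fin.forall_fin_succ, hij, hjk]

theorem strictMono_four {i j k l : ι} (hij : i < j) (hjk : j < k) (hkl : k < l) :
    StrictMono ![i, j, k, l] := by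
  simp [Fin.strictMono_iff_lt_succ, Fin.forall_fin_succ, hij, hjk, hkl]

/-- A homogeneous labeling of the edges `s(i, j)`, `i < j`, of a complete graph that increases from
an edge to edges on the right of it is one of the four canonical ones. Only the values `g i j` with
`i < j` matter. -/
theorem Homogeneous.exists_lex (hg : Homogeneous g)
    (hinj : ∀ i j i' j', i < j → i' < j' → g i j = g i' j' → i = i' ∧ j = j')
    {a₀ a₁ a₂ a₃ : ι} (h₀₁ : a₀ < a₁) (h₁₂ : a₁ < a₂) (h₂₃ : a₂ < a₃)
    (hright : g a₀ a₁ < g a₂ a₃) :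
    ∃ c : CanonicalType, ∀ i j i' j', i < j → i' < j' → c.Lex i j i' j' → g i j < g i' j' := by
  have ha := strictMono_three h₀₁ h₁₂
  have ha' := strictMono_three h₁₂ h₂₃
  have hb := strictMono_four h₀₁ h₁₂ h₂₃
  have three (p₀ p₁ p₂ p₃ : Fin 3) (h : p₀ < p₁) (h' : p₂ < p₃) (hne : p₀ ≠ p₂ ∨ p₁ ≠ p₃) :
      (∀ x : Fin 3 → ι, StrictMono x → g (x p₀) (x p₁) < g (x p₂) (x p₃)) ∨
      (∀ x : Fin 3 → ι, StrictMono x → g (x p₂) (x p₃) < g (x p₀) (x p₁)) := by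
    rcases lt_trichotomy (g (![a₀, a₁, a₂] p₀) (![a₀, a₁, a₂] p₁))
      (g (![a₀, a₁, a₂] p₂) (![a₀, a₁, a₂] p₃)) with hlt | heq | hgt
    · exact .inl fun x hx => (hg.lt_iff ha hx _ _ _ _).mp hlt
    · have := hinj _ _ _ _ (ha h) (ha h') heq
      simp only [ha.injective.eq_iff] at this
      tauto
    · exact .inr fun x hx => (hg.lt_iff ha hx _ _ _ _).mp hgt
  have four (p₀ p₁ p₂ p₃ : Fin 4) (h : p₀ < p₁) (h' : p₂ < p₃) (hne : p₀ ≠ p₂ ∨ p₁ ≠ p₃) :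
      (∀ x : Fin 4 → ι, StrictMono x → g (x p₀) (x p₁) < g (x p₂) (x p₃)) ∨
      (∀ x : Fin 4 → ι, StrictMono x → g (x p₂) (x p₃) < g (x p₀) (x p₁)) := by
    rcases lt_trichotomy (g (![a₀, a₁, a₂, a₃] p₀) (![a₀, a₁, a₂, a₃] p₁))
      (g (![a₀, a₁, a₂, a₃] p₂) (![a₀, a₁, a₂, a₃] p₃)) with hlt | heq | hgt
    · exact .inl fun x hx => (hg.lt_iff hb hx _ _ _ _).mp hlt
    · have := hinj _ _ _ _ (hb h) (hb h') heq
      simp only [hb.injective.eq_iff] at this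
      tauto
    · exact .inr fun x hx => (hg.lt_iff hb hx _ _ _ _).mp hgt
  have disj {i j k l} (hij : i < j) (hjk : j < k) (hkl : k < l) : g i j < g k l :=
    (hg.lt_iff hb (strictMono_four hij hjk hkl) 0 1 2 3).mp hright
  have path {i j k} (hij : i < j) (hjk : j < k) : g i j < g j k := by
    rcases three 0 1 1 2 (by decide) (by decide) (by decide) with h | h
    · exact h _ (strictMono_three hij hjk)
    · have h1 : g a₁ a₂ < g a₀ a₁ := h _ ha
      have h2 : g a₂ a₃ < g a₁ a₂ := h _ ha'
      omega
  have cross : (∀ i j k l, i < j → j < k → k < l → g i k < g j l) ∨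
      (∀ i j k l, i < j → j < k → k < l → g j l < g i k) :=
    (four 0 2 1 3 (by decide) (by decide) (by decide)).imp
      (fun h i j k l hij hjk hkl => h _ (strictMono_four hij hjk hkl))
      (fun h i j k l hij hjk hkl => h _ (strictMono_four hij hjk hkl))
  have nest : (∀ i j k l, i < j → j < k → k < l → g i l < g j k) ∨
      (∀ i j k l, i < j → j < k → k < l → g j k < g i l) :=
    (four 0 3 1 2 (by decide) (by decide) (by decide)).imp
      (fun h i j k l hij hjk hkl => h _ (strictMono_four hij hjk hkl))
      (fun h i j k l hij hjk hkl => h _ (strictMono_four hij hjk hkl))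
  have left : (∀ i j k, i < j → j < k → g i j < g i k) ∨
      (∀ i j k, i < j → j < k → g i k < g i j) :=
    (three 0 1 0 2 (by decide) (by decide) (by decide)).imp
      (fun h i j k hij hjk => h _ (strictMono_three hij hjk))
      (fun h i j k hij hjk => h _ (strictMono_three hij hjk))
  have right : (∀ i j k, i < j → j < k → g i k < g j k) ∨
      (∀ i j k, i < j → j < k → g j k < g i k) :=
    (three 0 2 1 2 (by decide) (by decide) (by decide)).imp
      (fun h i j k hij hjk => h _ (strictMono_three hij hjk))
      (fun h i j k hij hjk => h _ (strictMono_three hij hjk))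
  have crossing : ∀ i j k l, i < j → j < k → k < l → g i k < g j l := by
    -- If crossing edges decreased, the edges on `a₀, …, a₃` would contain a cycle whatever the
    -- behavior at a common endpoint is.
    refine cross.resolve_right fun h => ?_
    have h1 := h _ _ _ _ h₀₁ h₁₂ h₂₃
    have h2 := path h₀₁ h₁₂
    have h3 := path h₁₂ h₂₃
    have h4 := path (h₀₁.trans h₁₂) h₂₃
    have h5 := path h₀₁ (h₁₂.trans h₂₃)
    rcases left with hl | hl <;> rcases right with hr | hr
    all_goals
      have h6 := hl _ _ _ h₀₁ h₁₂
      have h7 := hl _ _ _ h₁₂ h₂₃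
      have h8 := hr _ _ _ h₀₁ h₁₂
      have h9 := hr _ _ _ h₁₂ h₂₃
      omega
  have step {i j i' j'} (hij : i < j) (hij' : i' < j') (hi : i < i') (hj : j < j') :
      g i j < g i' j' := by
    rcases lt_trichotomy j i' with h | rfl | h
    · exact disj hij h hij'
    · exact path hij hij'
    · exact crossing _ _ _ _ hi h hj
  rcases left with hl | hl <;> rcases right with hr | hr
  · rcases nest with hn | hn
    · refine ⟨.min, ?_⟩
      rintro i j i' j' hij hij' (hi | ⟨rfl, hj⟩)
      · rcases lt_trichotomy j j' with hj | rfl | hj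
        · exact step hij hij' hi hj
        · exact hr _ _ _ hi hij'
        · exact hn _ _ _ _ hi hij' hj
      · exact hl _ _ _ hij hj
    · refine ⟨.max, ?_⟩
      rintro i j i' j' hij hij' (hj | ⟨rfl, hi⟩)
      · rcases lt_trichotomy i i' with hi | rfl | hi
        · exact step hij hij' hi hj
        · exact hl _ _ _ hij hj
        · exact hn _ _ _ _ hi hij hj
      · exact hr _ _ _ hi hij'
  · refine ⟨.invMax, ?_⟩
    rintro i j i' j' hij hij' (hj | ⟨rfl, hi⟩)
    · rcases lt_trichotomy i i' with hi | rfl | hi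
      · exact step hij hij' hi hj
      · exact hl _ _ _ hij hj
      · exact (hr _ _ _ hi hij).trans (hl _ _ _ (hi.trans hij) hj)
    · exact hr _ _ _ hi hij
  · refine ⟨.invMin, ?_⟩
    rintro i j i' j' hij hij' (hi | ⟨rfl, hj⟩)
    · rcases lt_trichotomy j j' with hj | rfl | hj
      · exact step hij hij' hi hj
      · exact hr _ _ _ hi hij'
      · exact (hl _ _ _ (hi.trans hij') hj).trans (hr _ _ _ hi hij')
    · exact hl _ _ _ hij' hj
  -- The edges of a triangle would form a cycle.
  · have h1 := path h₀₁ h₁₂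
    have h2 := hl _ _ _ h₀₁ h₁₂
    have h3 := hr _ _ _ h₀₁ h₁₂
    omega

end Homogeneous

theorem exists_edge_eq_of_lt {n : ℕ} (e : (⊤ : SimpleGraph (Fin n)).edgeSet) :
    ∃ i j : Fin n, ∃ h : i < j, e = ⟨s(i, j), h.ne⟩ := by
  obtain ⟨e, he⟩ := e
  induction e with
  | _ x y =>
    rcases lt_or_gt_of_ne (show x ≠ y from he) with h | h
    · exact ⟨x, y, h, rfl⟩
    · exact ⟨y, x, h, Subtype.ext Sym2.eq_swap⟩

theorem completeLabel_mk (c : CanonicalType) {n : ℕ} {i j : Fin n} (h : i < j) :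
    completeLabel c n ⟨s(i, j), h.ne⟩ = c.label n (idx i) (idx j) := by
  simp [completeLabel, h.le]

/-- One implication in the comparison of labels is enough, both orders being linear. -/
theorem contains_canonicalComplete {N n : ℕ} {o : LinearOrder (⊤ : SimpleGraph (Fin N)).edgeSet}
    {g : Fin N → Fin N → ℕ}
    (hg : ∀ x y x' y' (h : x ≠ y) (h' : x' ≠ y'),
        o.lt ⟨s(x, y), h⟩ ⟨s(x', y'), h'⟩ ↔ g x y < g x' y')
    {c : CanonicalType} {ψ : Fin n → Fin N} (hψ : Function.Injective ψ)
    (hc : ∀ i j i' j', i < j → i' < j' → c.Lex i j i' j' →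
      g (ψ i) (ψ j) < g (ψ i') (ψ j')) :
    Contains ⟨Fin N, ⊤, o⟩ (canonicalComplete c n) := by
  let f : SimpleGraph.Copy (⊤ : SimpleGraph (Fin n)) (⊤ : SimpleGraph (Fin N)) :=
    ⟨⟨ψ, fun h => hψ.ne h⟩, hψ⟩
  have hlt (e e' : (⊤ : SimpleGraph (Fin n)).edgeSet)
      (h : completeLabel c n e < completeLabel c n e') :
      o.lt (f.mapEdgeSet e) (f.mapEdgeSet e') := by
    obtain ⟨i, j, hij, rfl⟩ := exists_edge_eq_of_lt e
    obtain ⟨i', j', hij', rfl⟩ := exists_edge_eq_of_lt e'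
    rw [completeLabel_mk c hij, completeLabel_mk c hij', c.label_lt_label_iff] at h
    exact (hg _ _ _ _ (hψ.ne hij.ne) (hψ.ne hij'.ne)).mpr (hc _ _ _ _ hij hij' h)
  exact ⟨f, fun e e' => ((@StrictMono.lt_iff_lt _ _ (canonicalComplete c n).order o.toPreorder
    f.mapEdgeSet hlt e e').symm)⟩

/-- Every edge-order of a large complete graph contains a canonical one. -/
theorem exists_contains_canonicalComplete (n : ℕ) : ∃ N : ℕ,
    ∀ o : LinearOrder (⊤ : SimpleGraph (Fin N)).edgeSet, ∃ c : CanonicalType,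
      Contains ⟨Fin N, ⊤, o⟩ (canonicalComplete c n) := by
  obtain ⟨N, hN⟩ := exists_orderEmbedding_homogeneous (Fin (n + 4)) Prop 4
  refine ⟨N, fun o => ?_⟩
  obtain ⟨g, hsymm, hg⟩ := exists_labeling o
  obtain ⟨φ, hφ⟩ := hN fun u => g (u 0) (u 1) < g (u 2) (u 3)
  have hhom : Homogeneous fun i j => g (φ i) (φ j) := fun u v huv => iff_of_eq (hφ u v huv)
  have hinj (i j i' j') (h : i ≠ j) (h' : i' ≠ j') (heq : g (φ i) (φ j) = g (φ i') (φ j')) :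
      s(i, j) = s(i', j') :=
    Sym2.map.injective φ.injective
      (labeling_inj hg (φ.injective.ne h) (φ.injective.ne h') heq)
  have hcast : StrictMono (Fin.castLE (Nat.le_add_right n 4)) := Fin.strictMono_castLE _
  have h₀₁ : (⟨0, by omega⟩ : Fin (n + 4)) < ⟨1, by omega⟩ := Fin.mk_lt_mk.mpr (by omega)
  have h₁₂ : (⟨1, by omega⟩ : Fin (n + 4)) < ⟨2, by omega⟩ := Fin.mk_lt_mk.mpr (by omega)
  have h₂₃ : (⟨2, by omega⟩ : Fin (n + 4)) < ⟨3, by omega⟩ := Fin.mk_lt_mk.mpr (by omega)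
  have hlex (c : CanonicalType) {ι : Type} [LinearOrder ι] {ψ : Fin n → ι} (hψ : StrictMono ψ)
      (i j i' j' : Fin n) (h : c.Lex i j i' j') : c.Lex (ψ i) (ψ j) (ψ i') (ψ j') := by
    cases c <;> simpa only [CanonicalType.Lex, hψ.lt_iff_lt, hψ.injective.eq_iff] using h
  rcases lt_trichotomy (g (φ ⟨0, by omega⟩) (φ ⟨1, by omega⟩))
    (g (φ ⟨2, by omega⟩) (φ ⟨3, by omega⟩)) with hlt | heq | hgt
  · obtain ⟨c, hc⟩ := hhom.exists_lex (fun i j i' j' h h' heq => by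
      have := hinj i j i' j' h.ne h'.ne heq
      simp only [Sym2.eq_iff] at this
      grind) h₀₁ h₁₂ h₂₃ hlt
    exact ⟨c, contains_canonicalComplete hg (φ.injective.comp hcast.injective)
      fun i j i' j' h h' hl => hc _ _ _ _ (hcast h) (hcast h') (hlex c hcast _ _ _ _ hl)⟩
  · have := hinj _ _ _ _ h₀₁.ne h₂₃.ne heq
    simp at this
  -- Reversing the order of the vertices, the labeling increases to the right again.
  · let g' : (Fin (n + 4))ᵒᵈ → (Fin (n + 4))ᵒᵈ → ℕ := fun i j =>
      g (φ (OrderDual.ofDual i)) (φ (OrderDual.ofDual j))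
    have hhom' : Homogeneous g' := fun u v huv =>
      hhom (OrderDual.ofDual ∘ u) (OrderDual.ofDual ∘ v) fun p q => huv q p
    obtain ⟨c, hc⟩ := hhom'.exists_lex (fun i j i' j' h h' heq => by
      have := hinj (OrderDual.ofDual i) (OrderDual.ofDual j) (OrderDual.ofDual i')
        (OrderDual.ofDual j') (OrderDual.ofDual_lt_ofDual.mpr h).ne'
        (OrderDual.ofDual_lt_ofDual.mpr h').ne' heq
      simp only [Sym2.eq_iff, OrderDual.ofDual_inj] at this
      grind)
      (OrderDual.toDual_lt_toDual.mpr h₂₃) (OrderDual.toDual_lt_toDual.mpr h₁₂)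
      (OrderDual.toDual_lt_toDual.mpr h₀₁) (by
        simp only [g', OrderDual.ofDual_toDual]
        rwa [hsymm (φ ⟨3, _⟩), hsymm (φ ⟨1, _⟩)])
    have hψ : StrictMono fun i : Fin n =>
        OrderDual.toDual (Fin.castLE (Nat.le_add_right n 4) i.rev) := fun i j hij =>
      OrderDual.toDual_lt_toDual.mpr (hcast (Fin.rev_lt_rev.mpr hij))
    exact ⟨c, contains_canonicalComplete hg
      (ψ := fun i => φ (Fin.castLE (Nat.le_add_right n 4) i.rev))
      (φ.injective.comp hψ.injective)
      fun i j i' j' h h' hl => hc _ _ _ _ (hψ h) (hψ h') (hlex c hψ _ _ _ _ hl)⟩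

theorem canonicalComplete_contains_of_le (c : CanonicalType) {m n : ℕ} (h : m ≤ n) :
    (canonicalComplete c n).Contains (canonicalComplete c m) := by
  obtain ⟨g, -, hg⟩ := exists_labeling (V := Fin n) (canonicalComplete c n).order
  refine contains_canonicalComplete hg (Fin.castLE_injective h) fun i j i' j' hij hij' hl => ?_
  have hcast : StrictMono (Fin.castLE h) := Fin.strictMono_castLE h
  refine (hg _ _ _ _ (hcast hij).ne (hcast hij').ne).mp ?_
  change completeLabel c n _ < completeLabel c n _
  refine ((completeLabel_mk c (hcast hij)).symm ▸ (completeLabel_mk c (hcast hij')).symm ▸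
    (c.label_lt_label_iff _ _ _ _).mpr ?_)
  cases c <;> simpa only [CanonicalType.Lex, hcast.lt_iff_lt, hcast.injective.eq_iff] using hl

/-! ### Canonical edge-orders of complete multipartite graphs -/

/-- A labeling of the edges of a complete bipartite graph whose comparisons only depend on the
order types of the endpoints in each of the two classes is one of the eight canonical ones on the
first `n` vertices of each class. Two spare vertices in each class provide test edges even if
`n < 2`. -/
theorem exists_partLabel {n m : ℕ} (hm : n + 2 ≤ m) {g : Fin m → Fin m → ℕ}
    (hinj : ∀ i j i' j', g i j = g i' j' → i = i' ∧ j = j')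
    (hg : ∀ i i' j j' k k' l l', (i < i' ↔ k < k') → (i' < i ↔ k' < k) → (j < j' ↔ l < l') →
      (j' < j ↔ l' < l) → (g i j < g i' j' ↔ g k l < g k' l')) :
    ∃ L ∈ partLabels n, ∀ i j i' j' : Fin n,
      g (i.castLE (by omega)) (j.castLE (by omega)) <
        g (i'.castLE (by omega)) (j'.castLE (by omega)) ↔
      L (idx i) (idx j) < L (idx i') (idx j') := by
  let z : Fin m := ⟨0, by omega⟩
  let o : Fin m := ⟨1, by omega⟩
  have hzo : z < o := Fin.mk_lt_mk.mpr one_pos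
  have h1 : (∀ i i' j, i < i' → g i j < g i' j) ∨ (∀ i i' j, i < i' → g i' j < g i j) := by
    rcases lt_trichotomy (g z z) (g o z) with h | h | h
    · exact .inl fun i i' j hi =>
        (hg z o z z i i' j j (by grind) (by grind) (by grind) (by grind)).mp h
    · exact absurd (hinj _ _ _ _ h).1 hzo.ne
    · exact .inr fun i i' j hi =>
        (hg o z z z i' i j j (by grind) (by grind) (by grind) (by grind)).mp h
  have h2 : (∀ i j j', j < j' → g i j < g i j') ∨ (∀ i j j', j < j' → g i j' < g i j) := by
    rcases lt_trichotomy (g z z) (g z o) with h | h | h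
    · exact .inl fun i j j' hj =>
        (hg z z z o i i j j' (by grind) (by grind) (by grind) (by grind)).mp h
    · exact absurd (hinj _ _ _ _ h).2 hzo.ne
    · exact .inr fun i j j' hj =>
        (hg z z o z i i j' j (by grind) (by grind) (by grind) (by grind)).mp h
  have h3 : (∀ i i' j j', i < i' → j < j' → g i j < g i' j') ∨
      (∀ i i' j j', i < i' → j < j' → g i' j' < g i j) := by
    rcases lt_trichotomy (g z z) (g o o) with h | h | h
    · exact .inl fun i i' j j' hi hj =>
        (hg z o z o i i' j j' (by grind) (by grind) (by grind) (by grind)).mp h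
    · exact absurd (hinj _ _ _ _ h).1 hzo.ne
    · exact .inr fun i i' j j' hi hj =>
        (hg o z o z i' i j' j (by grind) (by grind) (by grind) (by grind)).mp h
  have h4 : (∀ i i' j j', i < i' → j' < j → g i j < g i' j') ∨
      (∀ i i' j j', i < i' → j' < j → g i' j' < g i j) := by
    rcases lt_trichotomy (g z o) (g o z) with h | h | h
    · exact .inl fun i i' j j' hi hj =>
        (hg z o o z i i' j j' (by grind) (by grind) (by grind) (by grind)).mp h
    · exact absurd (hinj _ _ _ _ h).1 hzo.ne
    · exact .inr fun i i' j j' hi hj =>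
        (hg o z z o i' i j' j (by grind) (by grind) (by grind) (by grind)).mp h
  have hcast : StrictMono (Fin.castLE (show n ≤ m by omega)) := Fin.strictMono_castLE _
  rcases h1 with h1 | h1 <;> rcases h2 with h2 | h2 <;> rcases h3 with h3 | h3 <;>
    rcases h4 with h4 | h4
  all_goals
    have b1 := h1 z o z hzo
    have b2 := h1 z o o hzo
    have b3 := h2 z z o hzo
    have b4 := h2 o z o hzo
    have b5 := h3 z o z o hzo hzo
    have b6 := h4 z o o z hzo hzo
    try omega
  -- Eight combinations of the signs in `h1`, …, `h4` survive. The signs of `x` and `y` are those in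
  -- `h1` and `h2`; which of them gets the coefficient `n` is seen from `h3` if the two signs
  -- differ, and from `h4` if they agree.
  on_goal 1 => refine ⟨fun x y => n * x + y, by simp [partLabels], ?_⟩
  on_goal 2 => refine ⟨fun x y => n * y + x, by simp [partLabels], ?_⟩
  on_goal 3 => refine ⟨fun x y => n * x - y, by simp [partLabels], ?_⟩
  on_goal 4 => refine ⟨fun x y => -(n * y) + x, by simp [partLabels], ?_⟩
  on_goal 5 => refine ⟨fun x y => n * y - x, by simp [partLabels], ?_⟩
  on_goal 6 => refine ⟨fun x y => -(n * x) + y, by simp [partLabels], ?_⟩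
  on_goal 7 => refine ⟨fun x y => -(n * y) - x, by simp [partLabels], ?_⟩
  on_goal 8 => refine ⟨fun x y => -(n * x) - y, by simp [partLabels], ?_⟩
  all_goals
    intro i j i' j'
    simp only [sub_eq_add_neg, ← mul_neg]
    rw [mul_add_lt_mul_add_iff (by simp only [idx]; omega) (by simp only [idx]; omega)]
    simp only [idx]
    rcases lt_trichotomy i i' with hi | rfl | hi <;> rcases lt_trichotomy j j' with hj | rfl | hj
    all_goals
      try have ci := hcast hi
      try have cj := hcast hj
      clear hg hinj b1 b2 b3 b4 b5 b6
      grind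

/-- Every edge-order of a large complete `k`-partite graph contains a canonical one. -/
theorem exists_isCanonical (k n : ℕ) : ∃ N : ℕ,
    ∀ o : LinearOrder (SimpleGraph.completeEquipartiteGraph k N).edgeSet,
      ∃ o' : LinearOrder (SimpleGraph.completeEquipartiteGraph k n).edgeSet,
        IsCanonical o' ∧ (multipartite o).Contains (multipartite o') := by
  -- The lexicographic order makes the classes of the subgraph occupy disjoint intervals.
  obtain ⟨N, hN⟩ := exists_orderEmbedding_homogeneous (Fin k ×ₗ Fin (n + 2))
    ((Fin 4 → Fin k) → Prop) 4
  refine ⟨N, fun o => ?_⟩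
  obtain ⟨g, -, hg⟩ := exists_labeling o
  obtain ⟨φ, hφ⟩ := hN fun u c => g (c 0, u 0) (c 1, u 1) < g (c 2, u 2) (c 3, u 3)
  let ψ (v : Fin k × Fin (n + 2)) : Fin k × Fin N := (v.1, φ (toLex v))
  have hψ : Function.Injective ψ := fun v w h =>
    toLex.injective (φ.injective (congrArg Prod.snd h))
  have inv (c : Fin 4 → Fin k) (x y : Fin 4 → Fin (n + 2))
      (h : ∀ p q, c p = c q → (x p < x q ↔ y p < y q)) :
      g (ψ (c 0, x 0)) (ψ (c 1, x 1)) < g (ψ (c 2, x 2)) (ψ (c 3, x 3)) ↔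
        g (ψ (c 0, y 0)) (ψ (c 1, y 1)) < g (ψ (c 2, y 2)) (ψ (c 3, y 3)) := by
    refine iff_of_eq (congrFun (hφ (fun p => toLex (c p, x p)) (fun p => toLex (c p, y p))
      fun p q => ?_) c)
    rw [Prod.Lex.toLex_lt_toLex, Prod.Lex.toLex_lt_toLex]
    exact or_congr_right (and_congr_right (h p q))
  have hinj {a b c d : Fin k} {i j i' j' : Fin (n + 2)} (h : a ≠ b) (h' : c ≠ d)
      (heq : g (ψ (a, i)) (ψ (b, j)) = g (ψ (c, i')) (ψ (d, j'))) :
      s((a, i), (b, j)) = s((c, i'), (d, j')) :=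
    Sym2.map.injective hψ (labeling_inj hg (x := ψ (a, i)) (y := ψ (b, j)) (x' := ψ (c, i'))
      (y' := ψ (d, j')) h h' heq)
  have hle : n ≤ n + 2 := by omega
  let f : SimpleGraph.Copy (SimpleGraph.completeEquipartiteGraph k n)
      (SimpleGraph.completeEquipartiteGraph k N) :=
    ⟨⟨fun v => ψ (v.1, v.2.castLE hle), fun h => h⟩, fun v w h => by
      have := hψ h
      simp only [Prod.mk.injEq, Fin.castLE_inj] at this
      exact Prod.ext this.1 this.2⟩
  have hlt {a b c d : Fin k} (h : a ≠ b) (h' : c ≠ d) (i j i' j' : Fin n) :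
      (inducedOrder f o).lt (multiEdge h i j) (multiEdge h' i' j') ↔
        g (ψ (a, i.castLE hle)) (ψ (b, j.castLE hle)) <
          g (ψ (c, i'.castLE hle)) (ψ (d, j'.castLE hle)) :=
    hg (ψ (a, i.castLE hle)) (ψ (b, j.castLE hle)) (ψ (c, i'.castLE hle)) (ψ (d, j'.castLE hle))
      h h'
  refine ⟨inducedOrder f o, ⟨fun {a b} h => ?_, fun {a b c} h h' hbc => ?_,
    fun {a b c d} h h' hac had hbc hbd => ?_⟩, contains_inducedOrder f o⟩
  · obtain ⟨L, hL, hgL⟩ := exists_partLabel (n := n) le_rfl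
      (g := fun i j => g (ψ (a, i)) (ψ (b, j)))
      (fun i j i' j' heq => by
        have := hinj h h heq
        simpa [Sym2.eq_iff, h, h.symm] using this)
      (fun i i' j j' k k' l l' h1 h2 h3 h4 => by
        refine inv ![a, b, a, b] ![i, j, i', j'] ![k, l, k', l'] ?_
        simp [Fin.forall_fin_succ, h, h.symm, h1, h2, h3, h4])
    exact ⟨L, hL, fun i j i' j' => (hlt h h i j i' j').trans (hgL i j i' j')⟩
  · let T (i j i' j' : Fin (n + 2)) : Prop :=
      g (ψ (a, i)) (ψ (b, j)) < g (ψ (a, i')) (ψ (c, j'))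
    have hT {i i' l l' : Fin (n + 2)} (j j' r r' : Fin (n + 2)) (h1 : i < i' ↔ l < l')
        (h2 : i' < i ↔ l' < l) : T i j i' j' ↔ T l r l' r' := by
      refine inv ![a, b, a, c] ![i, j, i', j'] ![l, r, l', r'] ?_
      simp [Fin.forall_fin_succ, h, h.symm, h', h'.symm, hbc, hbc.symm, h1, h2]
    have hrev {i j i' j' : Fin (n + 2)} (hn : ¬ T i j i' j') :
        g (ψ (a, i')) (ψ (c, j')) < g (ψ (a, i)) (ψ (b, j)) := by
      refine lt_of_le_of_ne (not_lt.mp hn) fun heq => ?_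
      have := hinj h' h heq
      simp [h, hbc.symm] at this
    let z : Fin (n + 2) := ⟨0, by omega⟩
    let e : Fin (n + 2) := ⟨1, by omega⟩
    have hze : z < e := Fin.mk_lt_mk.mpr one_pos
    have hlt' (i j i' j' : Fin n) :
        (inducedOrder f o).lt (multiEdge h i j) (multiEdge h' i' j') ↔
          i < i' ∧ T z z e z ∨ i = i' ∧ T z z z z ∨ i' < i ∧ T e z z z := by
      rw [hlt h h' i j i' j']
      rcases lt_trichotomy i i' with hi | rfl | hi
      · have hc : i.castLE hle < i'.castLE hle := hi
        simp only [hi, hi.ne, hi.not_gt, true_and, false_and, or_false]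
        exact hT _ _ _ _ (by grind) (by grind)
      · simp only [lt_irrefl, true_and, false_and, or_false, false_or]
        exact hT _ _ _ _ (by grind) (by grind)
      · have hc : i'.castLE hle < i.castLE hle := hi
        simp only [hi, hi.ne', hi.not_gt, true_and, false_and, false_or]
        exact hT _ _ _ _ (by grind) (by grind)
    by_cases h1 : T z z e z <;> by_cases h2 : T z z z z <;> by_cases h3 : T e z z z
    all_goals simp only [h1, h2, h3, and_true, and_false, or_false, false_or] at hlt'
    · exact .inl fun i j i' j' => (hlt' i j i' j').mpr (lt_trichotomy i i')
    · exact .inr (.inr (.inr (.inl fun i j i' j' => (hlt' i j i' j').trans le_iff_lt_or_eq.symm)))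
    · have h4 := hrev h2
      have h5 : ¬ T e z e z := (hT z z z z (by grind) (by grind)).not.mpr h2
      have h6 := hrev h5
      simp only [T] at h1 h3
      omega
    · exact .inr (.inr (.inl hlt'))
    · refine .inr (.inr (.inr (.inr (.inr fun i j i' j' => (hlt' i j i' j').trans ?_))))
      rw [ge_iff_le, le_iff_lt_or_eq, or_comm, eq_comm]
    · -- The mirror image of the non-monotone pattern above.
      have h4 := hrev h1
      have h5 : T e z e z := (hT z z z z (by grind) (by grind)).mpr h2
      have h6 := hrev h3
      simp only [T] at h2 h5
      omega
    · exact .inr (.inr (.inr (.inr (.inl hlt'))))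
    · refine .inr (.inl fun i j i' j' => (hlt h' h i j i' j').mpr (hrev ?_))
      exact fun hT' => (hlt' i' j' i j).mp ((hlt h h' i' j' i j).mpr hT')
  · let z : Fin (n + 2) := ⟨0, by omega⟩
    have hT (i j i' j' : Fin (n + 2)) :
        g (ψ (a, i)) (ψ (b, j)) < g (ψ (c, i')) (ψ (d, j')) ↔
          g (ψ (a, z)) (ψ (b, z)) < g (ψ (c, z)) (ψ (d, z)) := by
      refine inv ![a, b, c, d] ![i, j, i', j'] ![z, z, z, z] ?_
      simp [Fin.forall_fin_succ, h, h.symm, h', h'.symm, hac, hac.symm, had, had.symm, hbc,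
        hbc.symm, hbd, hbd.symm]
    by_cases h0 : g (ψ (a, z)) (ψ (b, z)) < g (ψ (c, z)) (ψ (d, z))
    · exact .inl fun i j i' j' => (hlt h h' i j i' j').mpr ((hT _ _ _ _).mpr h0)
    · refine .inr fun i j i' j' => (hlt h' h i j i' j').mpr
        (lt_of_le_of_ne (not_lt.mp ((hT _ _ _ _).not.mpr h0)) fun heq => ?_)
      have := hinj h' h heq
      simp [hac.symm, had.symm, hbc.symm] at this

/-! ### The order chromatic number -/

theorem orderChromaticNumber_eq_top_iff {𝓗 : Set EdgeOrderedGraph.{v}} :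
    orderChromaticNumber 𝓗 = ⊤ ↔ ∀ n : ℕ, CanAvoid (⊤ : SimpleGraph (Fin n)) 𝓗 := by
  rw [orderChromaticNumber, sInf_eq_top]
  constructor
  · intro h n
    by_contra hn
    exact SimpleGraph.chromaticNumber_ne_top_iff_exists.mpr
      ⟨n, by simpa using (⊤ : SimpleGraph (Fin n)).colorable_of_fintype⟩
      (h _ ⟨Fin n, inferInstance, ⊤, hn, rfl⟩)
  · rintro h _ ⟨V, _, G, hG, rfl⟩
    have e := Finite.equivFin V
    exact absurd ((h _).of_copy
      ⟨⟨e, fun hxy => e.injective.ne hxy.ne⟩, e.injective⟩) hG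

theorem lt_orderChromaticNumber_iff {𝓗 : Set EdgeOrderedGraph.{v}} {k : ℕ} :
    (k : ℕ∞) < orderChromaticNumber 𝓗 ↔
      ∀ n : ℕ, CanAvoid (SimpleGraph.completeEquipartiteGraph k n) 𝓗 := by
  constructor
  · intro h n
    by_contra hn
    have hcol : (SimpleGraph.completeEquipartiteGraph k n).Colorable k :=
      ⟨SimpleGraph.Coloring.mk Prod.fst fun h => h⟩
    have hle : orderChromaticNumber 𝓗 ≤
        (SimpleGraph.completeEquipartiteGraph k n).chromaticNumber :=
      sInf_le ⟨_, inferInstance, _, hn, rfl⟩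
    exact h.not_ge (hle.trans (SimpleGraph.chromaticNumber_le_iff_colorable.mpr hcol))
  · intro h
    refine (ENat.natCast_lt_natCast.mpr k.lt_succ_self).trans_le (le_sInf ?_)
    rintro _ ⟨V, _, G, hG, rfl⟩
    rw [Nat.succ_eq_add_one, Nat.cast_add_one, ENat.add_one_le_iff (ENat.natCast_ne_top k)]
    by_contra hle
    obtain ⟨C⟩ := SimpleGraph.chromaticNumber_le_iff_colorable.mp (not_lt.mp hle)
    have e := Finite.equivFin V
    exact hG ((h _).of_copy ⟨⟨fun x => (C x, e x), fun hxy => C.valid hxy⟩,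
      fun x y hxy => e.injective (congrArg Prod.snd hxy)⟩)

theorem canAvoid_complete_tfae (𝓗 : Set EdgeOrderedGraph.{v}) :
    List.TFAE [∀ n : ℕ, CanAvoid (⊤ : SimpleGraph (Fin n)) 𝓗,
      ∃ c : CanonicalType, ∀ n : ℕ, (canonicalComplete c n).Avoids 𝓗,
      ∀ n : ℕ, ∃ c : CanonicalType, (canonicalComplete c n).Avoids 𝓗] := by
  tfae_have 1 → 3 := fun h n => by
    obtain ⟨N, hN⟩ := exists_contains_canonicalComplete n
    obtain ⟨o, ho⟩ := h N
    obtain ⟨c, hc⟩ := hN o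
    exact ⟨c, ho.mono hc⟩
  tfae_have 3 → 2 := fun h => by
    by_contra! hbad
    choose n hn using hbad
    obtain ⟨c, hc⟩ := h (max (max (n .min) (n .max)) (max (n .invMin) (n .invMax)))
    exact hn c (hc.mono (canonicalComplete_contains_of_le c (by cases c <;> simp)))
  tfae_have 2 → 1 := fun ⟨c, hc⟩ n => ⟨(canonicalComplete c n).order, hc n⟩
  tfae_finish

end EdgeOrderedGraph

theorem theorem2p5 (𝓗 : Set EdgeOrderedGraph.{v}) (h𝓗 : ∀ H ∈ 𝓗, H.graph.edgeSet.Nonempty) :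
    (EdgeOrderedGraph.orderChromaticNumber 𝓗 = ⊤ ↔
      ∃ c : EdgeOrderedGraph.CanonicalType, ∀ n : ℕ,
        (EdgeOrderedGraph.canonicalComplete c n).Avoids 𝓗) ∧
    (EdgeOrderedGraph.orderChromaticNumber 𝓗 = ⊤ ↔
      ∀ n : ℕ, ∃ c : EdgeOrderedGraph.CanonicalType,
        (EdgeOrderedGraph.canonicalComplete c n).Avoids 𝓗) ∧
    ∀ k : ℕ, 2 ≤ k →
      ((k : ℕ∞) < EdgeOrderedGraph.orderChromaticNumber 𝓗 ↔
        ∀ n : ℕ, ∃ o : LinearOrder (SimpleGraph.completeEquipartiteGraph k n).edgeSet,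
          EdgeOrderedGraph.IsCanonical o ∧ (EdgeOrderedGraph.multipartite o).Avoids 𝓗) := by
  have htfae := EdgeOrderedGraph.canAvoid_complete_tfae 𝓗
  rw [EdgeOrderedGraph.orderChromaticNumber_eq_top_iff]
  refine ⟨htfae.out 0 1, htfae.out 0 2, fun k _ => ?_⟩
  rw [EdgeOrderedGraph.lt_orderChromaticNumber_iff]
  constructor
  · intro h n
    obtain ⟨N, hN⟩ := EdgeOrderedGraph.exists_isCanonical k n
    obtain ⟨o, ho⟩ := h N
    obtain ⟨o', ho', hc⟩ := hN o
    exact ⟨o', ho', ho.mono hc⟩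
  · intro h n
    obtain ⟨o, -, ho⟩ := h n
    exact ⟨o, ho⟩
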